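/- Let $\mathbb D=\{z\in\mathbb C:|z|<1\}$ and let $\mathcal S$ be the class of all injective holomorphic functions $f:\mathbb D\to\mathbb C$ with $f(0)=0$ and $f'(0)=1$. A Herglotz function is a function $p:\mathbb D\times[0,+\infty)\to\mathbb C$ such that $p(z,\cdot)$ is locally integrable on $[0,+\infty)$ for each $z\in\mathbb D$, and for a.e. $t\ge 0$ the function $p(\cdot,t)$ is holomorphic in $\mathbb D$ with $\operatorname{Re}p(\cdot,t)\ge 0$. We say that $p$ generates $f\in\mathcal S$ if $$f(z)=\lim_{t\to+\infty}\frac{w(z,t)}{w'(0,t)}\quad\text{locally uniformly in }\mathbb D,$$ where $w'$ is the derivative with respect to $z$ and, for each $z\in\mathbb D$, $w(z,\cdot):[0,+\infty)\to\mathbb D$ is the (locally absolutely continuous) solution of the Loewner--Kufarev problem $$\frac{\mathrm dw}{\mathrm dt}=-w\,p(w,t)\ \text{ for a.e. }t\ge 0,\qquad w(z,0)=z.$$ For $k\in(0,1)$ we say that $p$ satisfies Becker's condition with constant $k$ if, for a.e. $t\ge0$, $$p(\mathbb D,t)\subset U(k):=\Big\{w\in\mathbb C:\Big|\frac{w-1}{w+1}\Big|\le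 k\Big\}.$$ Let $\widetilde{\mathcal S}_k$ be the class of all $f\in\mathcal S$ generated by some Herglotz function satisfying Becker's condition with constant $k$, and let $\mathcal S^B_k$ be the class of all $f\in\mathcal S$ generated by some Herglotz function $p$ satisfying Becker's condition with constant $k$ and, in addition, $p(0,t)=1$ for a.e. $t\ge 0$. Then for every $k\in(0,1)$, $$\widetilde{\mathcal S}_k\subset\mathcal S^B_{\kappa(k)},\qquad\text{where }\kappa(k):=\frac{2k}{1+k^2}.$$ -/

import Mathlib

open Set Filter Topology MeasureTheory

/-- The class `𝒮` of univalent (injective holomorphic) functions `f(z) = z + a₂ z² + …` on the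
unit disk. Functions are represented by maps `ℂ → ℂ`, of which only the values on the disk
matter. -/
def ClassS : Set (ℂ → ℂ) :=
  {f | DifferentiableOn ℂ f (Metric.ball 0 1) ∧ InjOn f (Metric.ball 0 1) ∧ f 0 = 0 ∧
    deriv f 0 = 1}

/-- Herglotz functions `p : 𝔻 × [0,∞) → ℂ`: locally integrable in `t` for each `z`, and for a.e.
`t ≥ 0` holomorphic in `z` with non-negative real part. -/
structure IsHerglotz (p : ℂ → ℝ → ℂ) : Prop where
  locallyIntegrable : ∀ z ∈ Metric.ball (0 : ℂ) 1, LocallyIntegrableOn (p z) (Ici 0) volume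
  holomorphic : ∀ᵐ t ∂(volume.restrict (Ici (0 : ℝ))),
    DifferentiableOn ℂ (fun z => p z t) (Metric.ball 0 1)
  re_nonneg : ∀ᵐ t ∂(volume.restrict (Ici (0 : ℝ))),
    ∀ z ∈ Metric.ball (0 : ℂ) 1, 0 ≤ (p z t).re

/-- `w = w(z,t)` solves, in the sense of Carathéodory, the Loewner–Kufarev initial value problem
`dw/dt = - w p(w,t)`, `w(z,0) = z ∈ 𝔻`: for each `z ∈ 𝔻`, the trajectory `t ↦ w(z,t)`, `t ≥ 0`,
stays in `𝔻`, is locally absolutely continuous, and satisfies the equation for a.e. `t ≥ 0`. -/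
structure IsLoewnerKufarevSolution (p w : ℂ → ℝ → ℂ) : Prop where
  initial : ∀ z ∈ Metric.ball (0 : ℂ) 1, w z 0 = z
  mem_disk : ∀ z ∈ Metric.ball (0 : ℂ) 1, ∀ t : ℝ, 0 ≤ t → w z t ∈ Metric.ball (0 : ℂ) 1
  absolutelyContinuous : ∀ z ∈ Metric.ball (0 : ℂ) 1, ∀ T : ℝ, 0 ≤ T →
    AbsolutelyContinuousOnInterval (w z) 0 T
  ode : ∀ z ∈ Metric.ball (0 : ℂ) 1, ∀ᵐ t ∂(volume.restrict (Ici (0 : ℝ))),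
    HasDerivAt (w z) (-(w z t * p (w z t) t)) t

/-- `f` is generated by `p`: it is the limit, locally uniform in `𝔻`, of `w(z,t) / w'(0,t)` as
`t → ∞`, where `w` solves the Loewner–Kufarev problem for `p` and `w'` is the `z`-derivative. -/
def Generates (p : ℂ → ℝ → ℂ) (f : ℂ → ℂ) : Prop :=
  ∃ w : ℂ → ℝ → ℂ, IsLoewnerKufarevSolution p w ∧
    TendstoLocallyUniformlyOn (fun (t : ℝ) (z : ℂ) => w z t / deriv (fun ζ => w ζ t) 0) f
      atTop (Metric.ball 0 1)

/-- `U(k) = {w : |(w - 1) / (w + 1)| ≤ k}`; the point `w = -1`, where the quotient is undefined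
(infinite), is excluded. -/
def beckerRegion (k : ℝ) : Set ℂ := {w | w ≠ -1 ∧ ‖(w - 1) / (w + 1)‖ ≤ k}

/-- Becker's condition with constant `k`: `p(𝔻, t) ⊆ U(k)` for a.e. `t ≥ 0`. -/
def BeckerCondition (k : ℝ) (p : ℂ → ℝ → ℂ) : Prop :=
  ∀ᵐ t ∂(volume.restrict (Ici (0 : ℝ))), ∀ z ∈ Metric.ball (0 : ℂ) 1, p z t ∈ beckerRegion k

/-- The class `𝒮̃_k`: functions in `𝒮` generated by a (not necessarily normalized) Herglotz
function satisfying Becker's condition with constant `k`. -/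
def ClassSTilde (k : ℝ) : Set (ℂ → ℂ) :=
  {f | f ∈ ClassS ∧ ∃ p : ℂ → ℝ → ℂ, IsHerglotz p ∧ BeckerCondition k p ∧ Generates p f}

/-- The class `𝒮_k^B`: functions in `𝒮` generated by a Herglotz function satisfying Becker's
condition with constant `k` and normalized by `p(0,t) = 1` for a.e. `t ≥ 0`. -/
def ClassSBecker (k : ℝ) : Set (ℂ → ℂ) :=
  {f | f ∈ ClassS ∧ ∃ p : ℂ → ℝ → ℂ, IsHerglotz p ∧
    (∀ᵐ t ∂(volume.restrict (Ici (0 : ℝ))), p 0 t = 1) ∧ BeckerCondition k p ∧ Generates p f}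

/-!
The Herglotz function is normalized by a rotation and a change of time. Let `p` generate `f` and
write `p(0,t) = a(t) + i b(t)`, `τ(t) = ∫₀ᵗ a`, `θ(t) = ∫₀ᵗ b`. If `w` solves the Loewner–Kufarev
problem for `p`, then `ŵ(z,τ(t)) = exp(i θ(t)) w(z,t)` solves it for
`p̂(z,τ(t)) = (p(exp(-i θ(t)) z, t) - i b(t)) / a(t)`, and `p̂(0,·) = 1`. The quotient
`w(z,t) / w'(0,t)` is unaffected by the rotation, so `p̂` generates `f` as well.

The region `U(k)` is a closed hyperbolic disk of the right half-plane centred at `1`, of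
pseudo-hyperbolic radius `k`. Any two of its points are therefore at pseudo-hyperbolic distance at
most `2k / (1 + k²)`. Since `w ↦ (w - i b) / a` is an automorphism of the half-plane carrying
`a + i b` to `1`, the values of `p̂` lie in `U(2k / (1 + k²))`; this is
`beckerRegion_normalize_mem`.

On `U(k)` the real part is bounded below and the modulus is bounded above, so `τ` is a
bi-Lipschitz homeomorphism (`exists_orderIso_primitive`). It therefore preserves null sets and
absolute continuity in both directions. The measurability of `p̂(z,·)`, where a
time-dependent point is inserted in `p(·,t)`, is that of a Carathéodory function
(`aestronglyMeasurable_comp_caratheodory`).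
-/

/-! ### The Becker region -/

lemma norm_sub_one_le_of_mem_beckerRegion {k : ℝ} {w : ℂ} (hw : w ∈ beckerRegion k) :
    ‖w - 1‖ ≤ k * ‖w + 1‖ := by
  obtain ⟨h1, h2⟩ := hw
  have : 0 < ‖w + 1‖ := norm_pos_iff.2 fun h => h1 (eq_neg_of_add_eq_zero_left h)
  rwa [norm_div, div_le_iff₀ this] at h2

lemma le_re_of_mem_beckerRegion {k : ℝ} {w : ℂ}
    (hw : w ∈ beckerRegion k) : (1 - k ^ 2) * ‖w + 1‖ ^ 2 ≤ 4 * w.re := by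
  have h := norm_sub_one_le_of_mem_beckerRegion hw
  have h2 : ‖w - 1‖ ^ 2 ≤ k ^ 2 * ‖w + 1‖ ^ 2 := by
    rw [← mul_pow]
    exact pow_le_pow_left₀ (norm_nonneg _) h 2
  have h3 : ‖w + 1‖ ^ 2 - ‖w - 1‖ ^ 2 = 4 * w.re := by
    simp only [Complex.sq_norm, Complex.normSq_apply, Complex.add_re, Complex.sub_re,
      Complex.add_im, Complex.sub_im, Complex.one_re, Complex.one_im]
    ring
  linarith

lemma re_pos_of_mem_beckerRegion {k : ℝ} (hk : k ∈ Ioo (0 : ℝ) 1) {w : ℂ}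
    (hw : w ∈ beckerRegion k) : 0 < w.re := by
  have h := le_re_of_mem_beckerRegion hw
  have h1 : 0 < ‖w + 1‖ := norm_pos_iff.2 fun h => hw.1 (eq_neg_of_add_eq_zero_left h)
  have h2 : 0 < 1 - k ^ 2 := by nlinarith [hk.1, hk.2]
  have : 0 < (1 - k ^ 2) * ‖w + 1‖ ^ 2 := by positivity
  linarith

lemma lower_bound_re_of_mem_beckerRegion {k : ℝ} (hk : k ∈ Ioo (0 : ℝ) 1) {w : ℂ}
    (hw : w ∈ beckerRegion k) : (1 - k ^ 2) / 4 ≤ w.re := by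
  have h := le_re_of_mem_beckerRegion hw
  have h0 := re_pos_of_mem_beckerRegion hk hw
  have h1 : 1 ≤ ‖w + 1‖ := by
    have := Complex.re_le_norm (w + 1)
    simp only [Complex.add_re, Complex.one_re] at this
    linarith
  have h2 : 0 < 1 - k ^ 2 := by nlinarith [hk.1, hk.2]
  have h3 : (1 - k ^ 2) * 1 ≤ (1 - k ^ 2) * ‖w + 1‖ ^ 2 :=
    mul_le_mul_of_nonneg_left (one_le_pow₀ h1) h2.le
  linarith

lemma norm_le_of_mem_beckerRegion {k : ℝ} (hk : k ∈ Ioo (0 : ℝ) 1) {w : ℂ}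
    (hw : w ∈ beckerRegion k) : ‖w‖ ≤ (1 + k) / (1 - k) := by
  have h := norm_sub_one_le_of_mem_beckerRegion hw
  have h1 : ‖w + 1‖ ≤ ‖w‖ + 1 := by simpa using norm_add_le w 1
  have h2 : ‖w‖ - 1 ≤ ‖w - 1‖ := by simpa using norm_sub_norm_le w 1
  have hk1 := hk.2
  rw [le_div_iff₀ (by linarith)]
  nlinarith [hk.1]

lemma one_mem_beckerRegion {k : ℝ} (hk : 0 ≤ k) : (1 : ℂ) ∈ beckerRegion k := by
  refine ⟨fun h => ?_, by simpa using hk⟩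
  have := congrArg Complex.re h
  norm_num at this

/-- The pseudo-hyperbolic distance between two points of `U(k)` is at most `2k / (1 + k²)`.
This follows from `|u + v̄|² - |u - v|² = 4 Re u Re v`, the estimate
`4 Re u ≥ (1 - k²) |u + 1|²` on `U(k)`, and
`2 (u + v̄) = (u + 1) (v̄ + 1) - (u - 1) (v̄ - 1)`. -/
lemma pseudohyperbolic_le_of_mem_beckerRegion {k : ℝ} (hk : k ∈ Ioo (0 : ℝ) 1) {u v : ℂ}
    (hu : u ∈ beckerRegion k) (hv : v ∈ beckerRegion k) :
    ‖u - v‖ ≤ 2 * k / (1 + k ^ 2) * ‖u + (starRingEnd ℂ) v‖ := by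
  have hk0 := hk.1
  have h1k : 0 < 1 - k ^ 2 := by nlinarith [hk.1, hk.2]
  have hu1 := le_re_of_mem_beckerRegion hu
  have hv1 := le_re_of_mem_beckerRegion hv
  have hid : ‖u + (starRingEnd ℂ) v‖ ^ 2 - ‖u - v‖ ^ 2 = 4 * u.re * v.re := by
    simp only [Complex.sq_norm, Complex.normSq_apply, Complex.add_re, Complex.sub_re,
      Complex.add_im, Complex.sub_im, Complex.conj_re, Complex.conj_im]
    ring
  have hv' : ‖(starRingEnd ℂ) v + 1‖ = ‖v + 1‖ := by
    rw [← Complex.norm_conj (v + 1)]; simp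
  have hv'' : ‖(starRingEnd ℂ) v - 1‖ = ‖v - 1‖ := by
    rw [← Complex.norm_conj (v - 1)]; simp
  have hsum : 2 * ‖u + (starRingEnd ℂ) v‖ ≤ (1 + k ^ 2) * (‖u + 1‖ * ‖v + 1‖) := by
    have e : (2 : ℂ) * (u + (starRingEnd ℂ) v) =
        (u + 1) * ((starRingEnd ℂ) v + 1) - (u - 1) * ((starRingEnd ℂ) v - 1) := by ring
    have e2 : 2 * ‖u + (starRingEnd ℂ) v‖ = ‖(2 : ℂ) * (u + (starRingEnd ℂ) v)‖ := by
      rw [norm_mul]; simp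
    have h1 := mul_le_mul (norm_sub_one_le_of_mem_beckerRegion hu)
      (norm_sub_one_le_of_mem_beckerRegion hv) (norm_nonneg _) (by positivity)
    have h2 := norm_sub_le ((u + 1) * ((starRingEnd ℂ) v + 1)) ((u - 1) * ((starRingEnd ℂ) v - 1))
    rw [norm_mul, norm_mul, hv', hv''] at h2
    rw [e2, e]
    linarith
  have hprod : (1 - k ^ 2) ^ 2 * (‖u + 1‖ * ‖v + 1‖) ^ 2 ≤ 16 * (u.re * v.re) := by
    have := mul_le_mul hu1 hv1 (by positivity)
      (by have := re_pos_of_mem_beckerRegion hk hu; positivity)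
    nlinarith
  have hsum2 : 4 * ‖u + (starRingEnd ℂ) v‖ ^ 2 ≤ (1 + k ^ 2) ^ 2 * (‖u + 1‖ * ‖v + 1‖) ^ 2 := by
    have := pow_le_pow_left₀ (by positivity) hsum 2
    nlinarith
  rw [div_mul_eq_mul_div, le_div_iff₀ (by positivity)]
  refine (sq_le_sq₀ (by positivity) (by positivity)).1 ?_
  have h3 := mul_le_mul_of_nonneg_left hsum2 (sq_nonneg (1 - k ^ 2))
  have h4 := mul_le_mul_of_nonneg_left hprod (sq_nonneg (1 + k ^ 2))
  have h5 : ‖u - v‖ ^ 2 = ‖u + (starRingEnd ℂ) v‖ ^ 2 - 4 * u.re * v.re := by linarith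
  rw [mul_pow, h5]
  nlinarith

/-- The automorphism of the half-plane carrying `v` to `1` maps `U(k) ∋ v` into
`U(2k / (1 + k²))`. -/
lemma beckerRegion_normalize_mem {k : ℝ} (hk : k ∈ Ioo (0 : ℝ) 1) {u v : ℂ}
    (hu : u ∈ beckerRegion k) (hv : v ∈ beckerRegion k) :
    (u - v.im * Complex.I) / v.re ∈ beckerRegion (2 * k / (1 + k ^ 2)) := by
  have hur := re_pos_of_mem_beckerRegion hk hu
  have hvr := re_pos_of_mem_beckerRegion hk hv
  have hvc : (v.re : ℂ) ≠ 0 := by exact_mod_cast hvr.ne'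
  have e1 : (u - v.im * Complex.I) / v.re - 1 = (u - v) / v.re := by
    rw [eq_div_iff hvc, sub_mul, div_mul_cancel₀ _ hvc]
    linear_combination - Complex.re_add_im v
  have e2 : (u - v.im * Complex.I) / v.re + 1 = (u + (starRingEnd ℂ) v) / v.re := by
    rw [eq_div_iff hvc, add_mul, div_mul_cancel₀ _ hvc]
    apply Complex.ext <;> simp
    ring
  have hne : u + (starRingEnd ℂ) v ≠ 0 := fun h => by
    have := congrArg Complex.re h
    simp at this
    linarith
  refine ⟨fun h => ?_, ?_⟩
  · have : (u - v.im * Complex.I) / v.re + 1 = 0 := by rw [h]; ring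
    rw [e2, div_eq_zero_iff] at this
    exact this.elim hne hvc
  · rw [e1, e2, div_div_div_cancel_right₀ hvc, norm_div, div_le_iff₀ (norm_pos_iff.2 hne)]
    exact pseudohyperbolic_le_of_mem_beckerRegion hk hu hv

/-! ### Measurability of Carathéodory functions -/

lemma aestronglyMeasurable_comp_simpleFunc {α X E : Type*} [MeasurableSpace α]
    [NormedAddCommGroup E] {μ : Measure α} {f : X → α → E} {S : Set X}
    (hf : ∀ x ∈ S, AEStronglyMeasurable (f x) μ) (φ : SimpleFunc α X) (hφ : ∀ t, φ t ∈ S) :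
    AEStronglyMeasurable (fun t => f (φ t) t) μ := by
  classical
  have e : (fun t => f (φ t) t) = fun t => ∑ x ∈ φ.range, (φ ⁻¹' {x}).indicator (f x) t := by
    funext t
    rw [Finset.sum_eq_single_of_mem (φ t) (φ.mem_range_self t)]
    · simp
    · intro x _ hx
      simp [indicator, hx.symm]
  rw [e]
  refine Finset.aestronglyMeasurable_fun_sum _ fun x hx => ?_
  obtain ⟨t, rfl⟩ := SimpleFunc.mem_range.1 hx
  exact (hf _ (hφ t)).indicator (φ.measurableSet_fiber _)

/-- A function measurable in `t` and continuous in `x` is measurable along a measurable curve. -/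
lemma aestronglyMeasurable_comp_caratheodory {α X E : Type*} [MeasurableSpace α]
    [PseudoMetricSpace X] [SecondCountableTopology X] [MeasurableSpace X] [BorelSpace X]
    [NormedAddCommGroup E] {μ : Measure α} {f : X → α → E} {S : Set X}
    (hf : ∀ x ∈ S, AEStronglyMeasurable (f x) μ)
    (hc : ∀ᵐ t ∂μ, ContinuousOn (fun x => f x t) S)
    {u : α → X} (hu : Measurable u) (huS : ∀ t, u t ∈ S) :
    AEStronglyMeasurable (fun t => f (u t) t) μ := by
  rcases isEmpty_or_nonempty α with h | ⟨⟨t₀⟩⟩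
  · exact (aestronglyMeasurable_const (b := (0 : E))).congr (.of_forall fun t => isEmptyElim t)
  let φ := SimpleFunc.approxOn u hu S (u t₀) (huS t₀)
  have hφ : ∀ n t, φ n t ∈ S := fun n t => SimpleFunc.approxOn_mem hu (huS t₀) n t
  refine aestronglyMeasurable_of_tendsto_ae atTop
    (fun n => aestronglyMeasurable_comp_simpleFunc hf (φ n) (hφ n)) ?_
  filter_upwards [hc] with t ht
  refine (ht (u t) (huS t)).tendsto.comp ?_
  exact tendsto_nhdsWithin_iff.2 ⟨SimpleFunc.tendsto_approxOn hu (huS t₀) (subset_closure (huS t)),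
    .of_forall fun n => hφ n t⟩

/-! ### Changes of time -/

lemma locallyIntegrable_of_norm_le {E : Type*} [NormedAddCommGroup E] {μ : Measure ℝ}
    [IsLocallyFiniteMeasure μ] {g : ℝ → E} {C : ℝ} (hm : AEStronglyMeasurable g μ)
    (hC : ∀ᵐ t ∂μ, ‖g t‖ ≤ C) : LocallyIntegrable g μ :=
  (locallyIntegrable_const C).mono hm <| hC.mono fun _ ht => ht.trans (Real.le_norm_self C)

lemma lipschitzWith_primitive {g : ℝ → ℝ} {C : ℝ} (hm : AEStronglyMeasurable g volume)
    (hC : ∀ t, ‖g t‖ ≤ C) : LipschitzWith C.toNNReal (fun t => ∫ s in (0 : ℝ)..t, g s) := by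
  have hi : ∀ x y, IntervalIntegrable g volume x y := fun x y =>
    ((locallyIntegrable_of_norm_le hm (.of_forall hC)).integrableOn_isCompact
      isCompact_uIcc).intervalIntegrable
  refine LipschitzWith.of_dist_le_mul fun x y => ?_
  rw [Real.coe_toNNReal _ ((norm_nonneg _).trans (hC 0)), dist_eq_norm,
    intervalIntegral.integral_interval_sub_left (hi _ _) (hi _ _), Real.dist_eq]
  exact intervalIntegral.norm_integral_le_of_norm_le_const fun t _ => hC t

/-- The primitive of a measurable function with values between two positive constants is a
bi-Lipschitz change of time. -/
lemma exists_orderIso_primitive {a : ℝ → ℝ} {c C : ℝ} (hm : AEStronglyMeasurable a volume)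
    (hc : 0 < c) (hca : ∀ t, c ≤ a t) (haC : ∀ t, ‖a t‖ ≤ C) :
    ∃ τ : ℝ ≃o ℝ, τ 0 = 0 ∧ (∃ K, LipschitzWith K τ) ∧ (∃ K, LipschitzWith K τ.symm) ∧
      ∀ᵐ t, HasDerivAt τ (a t) t := by
  have hL := locallyIntegrable_of_norm_le hm (.of_forall haC)
  have hi : ∀ x y, IntervalIntegrable a volume x y := fun x y =>
    (hL.integrableOn_isCompact isCompact_uIcc).intervalIntegrable
  have hlip := lipschitzWith_primitive hm haC
  have hder := _root_.LocallyIntegrable.ae_hasDerivAt_integral hL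
  have h0 : ∫ s in (0 : ℝ)..0, a s = 0 := intervalIntegral.integral_same
  set T : ℝ → ℝ := fun t => ∫ s in (0 : ℝ)..t, a s with hT
  have hgrow : ∀ x y, x ≤ y → c * (y - x) ≤ T y - T x := by
    intro x y hxy
    rw [hT]
    simp only
    rw [intervalIntegral.integral_interval_sub_left (hi _ _) (hi _ _)]
    have := intervalIntegral.integral_mono_on hxy (intervalIntegrable_const (c := c)) (hi x y)
      fun t _ => hca t
    simpa [mul_comm] using this
  have hmono : StrictMono T := fun x y hxy => by
    have := hgrow x y hxy.le
    nlinarith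
  have hsurj : Function.Surjective T := by
    refine hlip.continuous.surjective ?_ ?_
    · refine tendsto_atTop_mono' _ ?_ (tendsto_id.const_mul_atTop hc)
      filter_upwards [eventually_ge_atTop 0] with t ht
      have := hgrow 0 t ht
      simp only [id]
      linarith
    · refine tendsto_atBot_mono' _ ?_ (tendsto_id.const_mul_atBot hc)
      filter_upwards [eventually_le_atBot 0] with t ht
      have := hgrow t 0 ht
      simp only [id]
      linarith
  refine ⟨hmono.orderIsoOfSurjective T hsurj, h0, ⟨_, hlip⟩, ⟨(c⁻¹).toNNReal, ?_⟩, ?_⟩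
  · refine LipschitzWith.of_le_add_mul _ fun x y => ?_
    set σ := (hmono.orderIsoOfSurjective T hsurj).symm
    have hσ : ∀ x, T (σ x) = x := (hmono.orderIsoOfSurjective T hsurj).apply_symm_apply
    rw [Real.coe_toNNReal _ (by positivity), Real.dist_eq, ← sub_le_iff_le_add',
      ← div_eq_inv_mul, le_div_iff₀ hc]
    rcases le_total (σ y) (σ x) with h | h
    · have := hgrow _ _ h
      rw [hσ, hσ] at this
      linarith [le_abs_self (x - y)]
    · exact (mul_nonpos_of_nonpos_of_nonneg (by linarith) hc.le).trans (abs_nonneg _)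
  · filter_upwards [hder] with t ht
    exact ht 0

/-- Lipschitz maps of the line carry null sets to null sets, so a bijection with Lipschitz inverse
pulls null sets back to null sets. -/
lemma quasiMeasurePreserving_symm {τ : ℝ ≃o ℝ} {K : NNReal} (hτ : LipschitzWith K τ) :
    Measure.QuasiMeasurePreserving τ.symm volume volume := by
  refine ⟨τ.symm.continuous.measurable, Measure.AbsolutelyContinuous.mk fun s hs h0 => ?_⟩
  rw [Measure.map_apply τ.symm.continuous.measurable hs]
  have e : τ.symm ⁻¹' s = τ '' s := (τ.toEquiv.image_eq_preimage_symm s).symm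
  have h := (hτ.lipschitzOnWith (s := s)).hausdorffMeasure_image_le (d := 1) zero_le_one
  rw [hausdorffMeasure_real, h0, mul_zero] at h
  rw [e]
  exact le_antisymm h bot_le

lemma AbsolutelyContinuousOnInterval.comp_monotone_lipschitz {X : Type*} [PseudoMetricSpace X]
    {f : ℝ → X} {σ : ℝ → ℝ} {a b : ℝ} {K : NNReal} (hσ : Monotone σ) (hK : LipschitzWith K σ)
    (hf : AbsolutelyContinuousOnInterval f (σ a) (σ b)) :
    AbsolutelyContinuousOnInterval (f ∘ σ) a b := by
  rw [absolutelyContinuousOnInterval_iff] at hf ⊢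
  intro ε hε
  obtain ⟨δ, hδ, h⟩ := hf ε hε
  refine ⟨δ / (K + 1), by positivity, fun E hE hlen => ?_⟩
  refine h (E.1, fun i => (σ (E.2 i).1, σ (E.2 i).2)) ⟨fun i hi => ?_, fun i hi j hj hij => ?_⟩ ?_
  · obtain ⟨h1, h2⟩ := hE.1 i hi
    exact ⟨hσ.image_uIcc_subset ⟨_, h1, rfl⟩, hσ.image_uIcc_subset ⟨_, h2, rfl⟩⟩
  · have hd := hE.2 hi hj hij
    simp only [Function.onFun, uIoc, ← hσ.map_min, ← hσ.map_max] at hd ⊢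
    rw [Set.disjoint_iff_inter_eq_empty, Ioc_inter_Ioc, Ioc_eq_empty_iff, not_lt] at hd ⊢
    rw [← hσ.map_min, ← hσ.map_max]
    exact hσ hd
  · calc ∑ i ∈ Finset.range E.1, dist (σ (E.2 i).1) (σ (E.2 i).2)
        ≤ ∑ i ∈ Finset.range E.1, K * dist (E.2 i).1 (E.2 i).2 :=
          Finset.sum_le_sum fun i _ => hK.dist_le_mul _ _
      _ = K * ∑ i ∈ Finset.range E.1, dist (E.2 i).1 (E.2 i).2 := by rw [Finset.mul_sum]
      _ ≤ (K + 1) * ∑ i ∈ Finset.range E.1, dist (E.2 i).1 (E.2 i).2 := by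
          gcongr
          linarith
      _ < δ := by rwa [lt_div_iff₀' (by positivity)] at hlen

lemma lipschitzWith_exp_ofReal_mul_I : LipschitzWith 1 fun x : ℝ => Complex.exp (x * Complex.I) := by
  refine lipschitzWith_of_nnnorm_deriv_le (𝕜 := ℝ) (fun x => ?_) fun x => ?_
  · fun_prop
  · have h : HasDerivAt (fun x : ℝ => Complex.exp (x * Complex.I))
        (Complex.exp (x * Complex.I) * (1 * Complex.I)) x :=
      ((Complex.ofRealCLM.hasDerivAt (x := x)).mul_const Complex.I).cexp
    rw [h.deriv, ← NNReal.coe_le_coe]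
    simp

/-! ### Normalization of the Herglotz function -/

lemma exp_mul_mem_ball {x : ℝ} {z : ℂ} (hz : z ∈ Metric.ball (0 : ℂ) 1) :
    Complex.exp (x * Complex.I) * z ∈ Metric.ball (0 : ℂ) 1 := by
  simpa [Complex.norm_exp_ofReal_mul_I] using hz

/-- The Herglotz function `p`, rotated by the angle `-θ`, normalized by means of `g = p(0,·)`, and
reparametrized by the change of time `σ`. -/
noncomputable def normalizedHerglotz (p : ℂ → ℝ → ℂ) (g : ℝ → ℂ) (θ σ : ℝ → ℝ) :
    ℂ → ℝ → ℂ := fun z s =>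
  (p (Complex.exp ((-θ (σ s) : ℝ) * Complex.I) * z) (σ s) - (g (σ s)).im * Complex.I) /
    (g (σ s)).re

theorem mainTheorem8 (k : ℝ) (hk : k ∈ Set.Ioo (0 : ℝ) 1) :
    ClassSTilde k ⊆ ClassSBecker (2 * k / (1 + k ^ 2)) := by
  classical
  rintro f ⟨hfS, p, hp, hpk, w, hw, hlim⟩
  refine ⟨hfS, ?_⟩
  have hκ : 2 * k / (1 + k ^ 2) ∈ Ioo (0 : ℝ) 1 := by
    obtain ⟨h0, h1⟩ := hk
    refine ⟨by positivity, ?_⟩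
    rw [div_lt_one (by positivity)]
    nlinarith [sq_pos_of_pos (sub_pos.2 h1)]
  have hz0 : (0 : ℂ) ∈ Metric.ball (0 : ℂ) 1 := by simp
  -- `g` agrees with `p(0,·)` for a.e. `t ≥ 0`, and is in `U(k)` for every real `t`.
  let g : ℝ → ℂ := fun t => if 0 ≤ t ∧ p 0 t ∈ beckerRegion k then p 0 t else 1
  have hgU : ∀ t, g t ∈ beckerRegion k := by
    intro t
    by_cases h : 0 ≤ t ∧ p 0 t ∈ beckerRegion k
    · simp only [g, if_pos h]; exact h.2
    · simp only [g, if_neg h]; exact one_mem_beckerRegion hk.1.le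
  have hgp : ∀ᵐ t ∂(volume.restrict (Ici (0 : ℝ))), g t = p 0 t := by
    filter_upwards [hpk, ae_restrict_mem measurableSet_Ici] with t h1 h2
    exact if_pos ⟨h2, h1 0 hz0⟩
  have hgm : AEStronglyMeasurable g volume := by
    have h1 : AEStronglyMeasurable g (volume.restrict (Ici (0 : ℝ))) :=
      (hp.locallyIntegrable 0 hz0).aestronglyMeasurable.congr (hgp.mono fun t h => h.symm)
    have h2 : AEStronglyMeasurable g (volume.restrict (Ici (0 : ℝ))ᶜ) := by
      refine (aestronglyMeasurable_const (b := (1 : ℂ))).congr ?_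
      filter_upwards [ae_restrict_mem measurableSet_Ici.compl] with t ht
      exact (if_neg fun h => ht h.1).symm
    have := aestronglyMeasurable_union_iff.2 ⟨h1, h2⟩
    rwa [union_compl_self, Measure.restrict_univ] at this
  have hgC := fun t => norm_le_of_mem_beckerRegion hk (hgU t)
  have hgr := fun t => re_pos_of_mem_beckerRegion hk (hgU t)
  obtain ⟨τ, hτ0, ⟨K, hτK⟩, ⟨L, hσL⟩, hτd⟩ := exists_orderIso_primitive
    (Complex.continuous_re.comp_aestronglyMeasurable hgm)
    (by nlinarith [hk.1, hk.2] : 0 < (1 - k ^ 2) / 4)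
    (fun t => lower_bound_re_of_mem_beckerRegion hk (hgU t))
    (fun t => (Complex.abs_re_le_norm _).trans (hgC t))
  have him : AEStronglyMeasurable (fun t => (g t).im) volume :=
    Complex.continuous_im.comp_aestronglyMeasurable hgm
  have himC : ∀ t, ‖(g t).im‖ ≤ (1 + k) / (1 - k) := fun t =>
    (Complex.abs_im_le_norm _).trans (hgC t)
  have hθL := lipschitzWith_primitive him himC
  have hθd : ∀ᵐ t, HasDerivAt (fun t => ∫ s in (0 : ℝ)..t, (g s).im) (g t).im t :=
    
    (_root_.LocallyIntegrable.ae_hasDerivAt_integral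
      (locallyIntegrable_of_norm_le him (.of_forall himC))).mono fun t ht => ht 0
  set θ : ℝ → ℝ := fun t => ∫ s in (0 : ℝ)..t, (g s).im
  have hσ0 : τ.symm 0 = 0 := by rw [τ.symm_apply_eq, hτ0]
  have hσnn : ∀ s, 0 ≤ s → 0 ≤ τ.symm s := fun s hs => hσ0 ▸ τ.symm.monotone hs
  have hσq := quasiMeasurePreserving_symm hτK
  have hσr : Measure.QuasiMeasurePreserving τ.symm (volume.restrict (Ici (0 : ℝ)))
      (volume.restrict (Ici (0 : ℝ))) := hσq.restrict fun s hs => hσnn s hs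
  have hpk' := hσr.ae hpk
  have hBecker : BeckerCondition (2 * k / (1 + k ^ 2)) (normalizedHerglotz p g θ τ.symm) := by
    filter_upwards [hpk'] with s hs z hz
    exact beckerRegion_normalize_mem hk (hs _ (exp_mul_mem_ball hz)) (hgU _)
  refine ⟨normalizedHerglotz p g θ τ.symm, ⟨fun z hz => ?_, ?_, ?_⟩, ?_, hBecker,
    fun z s => Complex.exp (θ (τ.symm s) * Complex.I) * w z (τ.symm s), ⟨?_, ?_, ?_, ?_⟩, ?_⟩
  · have hu : Measurable fun t => Complex.exp ((-θ t : ℝ) * Complex.I) * z := by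
      have := hθL.continuous
      exact Continuous.measurable (by fun_prop)
    have h1 : AEStronglyMeasurable
        (fun t => p (Complex.exp ((-θ t : ℝ) * Complex.I) * z) t)
        (volume.restrict (Ici (0 : ℝ))) :=
      aestronglyMeasurable_comp_caratheodory
        (fun x hx => (hp.locallyIntegrable x hx).aestronglyMeasurable)
        (hp.holomorphic.mono fun t ht => ht.continuousOn) hu fun t => exp_mul_mem_ball hz
    have h2 : AEStronglyMeasurable (fun t => (p (Complex.exp ((-θ t : ℝ) * Complex.I) * z) t -
        (g t).im * Complex.I) * ((g t).re : ℂ)⁻¹) (volume.restrict (Ici (0 : ℝ))) := by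
      have hg := hgm.restrict (s := Ici (0 : ℝ))
      refine (h1.sub ((Complex.continuous_ofReal.comp_aestronglyMeasurable
        (Complex.continuous_im.comp_aestronglyMeasurable hg)).mul_const _)).mul ?_
      exact ((Complex.continuous_ofReal.comp_aestronglyMeasurable
        (Complex.continuous_re.comp_aestronglyMeasurable hg)).aemeasurable.inv).aestronglyMeasurable
    have h3 : AEStronglyMeasurable (normalizedHerglotz p g θ τ.symm z)
        (volume.restrict (Ici (0 : ℝ))) := by
      simpa only [normalizedHerglotz, div_eq_mul_inv] using! h2.comp_quasiMeasurePreserving hσr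
    -- Becker's condition bounds `p̂(z,·)`, so measurability is all that local integrability needs
    refine locallyIntegrableOn_of_locallyIntegrable_restrict
      (locallyIntegrable_of_norm_le h3 (hBecker.mono fun s hs =>
        norm_le_of_mem_beckerRegion hκ (hs z hz)))
  · filter_upwards [hσr.ae hp.holomorphic] with s hs
    refine (DifferentiableOn.sub_const ?_ _).div_const _
    exact hs.comp (by fun_prop) fun z hz => exp_mul_mem_ball hz
  · filter_upwards [hBecker] with s hs z hz
    exact (re_pos_of_mem_beckerRegion hκ (hs z hz)).le
  · filter_upwards [hσr.ae hgp] with s hs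
    have : ((g (τ.symm s)).re : ℂ) ≠ 0 := by exact_mod_cast (hgr _).ne'
    rw [normalizedHerglotz, mul_zero, ← hs, div_eq_one_iff_eq this]
    linear_combination - Complex.re_add_im (g (τ.symm s))
  · intro z hz
    simp only [hσ0]
    rw [hw.initial z hz]
    simp [θ]
  · intro z hz s hs
    exact exp_mul_mem_ball (hw.mem_disk z hz _ (hσnn s hs))
  · intro z hz S hS
    have h1 : AbsolutelyContinuousOnInterval (w z ∘ τ.symm) 0 S := by
      refine AbsolutelyContinuousOnInterval.comp_monotone_lipschitz τ.symm.monotone hσL ?_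
      rw [hσ0]
      exact hw.absolutelyContinuous z hz _ (hσnn S hS)
    have h2 : AbsolutelyContinuousOnInterval
        (fun s => Complex.exp (θ (τ.symm s) * Complex.I)) 0 S :=
      ((lipschitzWith_exp_ofReal_mul_I.comp (hθL.comp hσL)).lipschitzOnWith
        (s := uIcc 0 S)).absolutelyContinuousOnInterval
    exact h2.smul h1
  · intro z hz
    filter_upwards [hσr.ae (hw.ode z hz), hσr.ae (ae_restrict_of_ae hτd),
      hσr.ae (ae_restrict_of_ae hθd)] with s hws hτs hθs
    have hgc : ((g (τ.symm s)).re : ℂ) ≠ 0 := by exact_mod_cast (hgr _).ne'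
    have hσs : HasDerivAt τ.symm (g (τ.symm s)).re⁻¹ s :=
      hτs.of_local_left_inverse τ.symm.continuous.continuousAt (hgr _).ne'
        (.of_forall τ.apply_symm_apply)
    have hexp := ((hθs.comp s hσs).ofReal_comp.mul_const Complex.I).cexp
    have hwσ := hws.scomp s hσs
    refine (hexp.mul hwσ).congr_deriv ?_
    -- undoing the rotation recovers the point `w(z,t)` at which `p` is evaluated
    have hrot : Complex.exp ((-θ (τ.symm s) : ℝ) * Complex.I) *
        (Complex.exp (θ (τ.symm s) * Complex.I) * w z (τ.symm s)) = w z (τ.symm s) := by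
      rw [← mul_assoc, ← Complex.exp_add]
      simp
    simp only [normalizedHerglotz, hrot, Function.comp_apply, Complex.real_smul]
    push_cast
    field_simp
    ring
  · have hσtop : Tendsto τ.symm atTop atTop := τ.symm.tendsto_atTop
    have h1 : TendstoLocallyUniformlyOn
        (fun (s : ℝ) (z : ℂ) => w z (τ.symm s) / deriv (fun ζ => w ζ (τ.symm s)) 0) f
        atTop (Metric.ball 0 1) := by
      intro u hu z hz
      obtain ⟨t, ht, h⟩ := hlim u hu z hz
      exact ⟨t, ht, hσtop.eventually h⟩
    -- the rotation factor cancels between `ŵ(z,s)` and `ŵ'(0,s)`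
    refine h1.congr fun s z _ => ?_
    simp only
    rw [deriv_const_mul_field, mul_div_mul_left _ _ (Complex.exp_ne_zero _)]
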